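/- All graphs are finite, simple and undirected. A path in a graph some of whose vertices are colored is called *vertex-proper* if all its internal vertices are colored and any two adjacent internal vertices of the path have different colors (so a path of length at most $1$ is always vertex-proper, even if no vertex is colored). A $u$-$v$ *geodesic* is a $u$-$v$ path of length $d(u,v)$. For a connected graph $G$, the *strong proper vertex-connection number* $spvc(G)$ is the smallest number $k\ge 0$ of colors for which the vertices of $G$ can be colored so that any two vertices are joined by a vertex-proper geodesic (thus $spvc(G)=0$ exactly when $G$ is complete). **Theorem.** Let $G$ be a connected graph of order $n\ge 2$. Then $spvc(G)=n-3$ if and only if $G$ is isomorphic to one of the following twelve graphs: - of order $3$: the triangle $K_3$; - of order $4$: the star $K_{1,3}$; the cycle $C_4$; the paw (a triangle with one pendant vertex); the diamond ($K_4$ minus an edge); - of order $5$: the path $P_5$; the fork ($K_{1,3}$ with one edge subdivided once); the bull (a triangle with one pendant vertex attached to each of two of its vertices); the triangle with a pendant path of length $2$ attached to one of its vertices; the banner ($C_4$ with one pendant vertex); the kite (the diamond with a pendant vertex attached to one of its vertices of degree $2$); - of order $6$: the net (a triangle with one pendant vertex attached to each of its vertices). -/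

import Mathlib

namespace SimpleGraph

variable {V : Type*}

/-- A `u`-`v` geodesic of `G`: a `u`-`v` path whose length is the distance of `u` and `v`. -/
def IsGeodesic (G : SimpleGraph V) {u v : V} (p : G.Walk u v) : Prop :=
  p.IsPath ∧ p.length = G.dist u v

/-- A vertex-coloring with (at most) `k` colors is a map `c : V → Option (Fin k)`, where
`c x = none` says that `x` receives no color. A path is vertex-proper under `c` if all its
internal vertices (those at a position `i` with `0 < i < length`) are colored, and consecutive
internal vertices differ in color. Vertices that are left uncolored are thus of no use as internal
vertices; they are allowed so that `k = 0` is meaningful (complete graphs need no color at all).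
For `k ≥ 1`, coloring the remaining vertices arbitrarily makes every coloring total. -/
def IsVertexProper {G : SimpleGraph V} {k : ℕ} (c : V → Option (Fin k)) {u v : V}
    (p : G.Walk u v) : Prop :=
  (∀ i, 0 < i → i < p.length → c (p.getVert i) ≠ none) ∧
    ∀ i, 0 < i → i + 1 < p.length → c (p.getVert i) ≠ c (p.getVert (i + 1))

/-- The coloring `c` makes `G` strong proper vertex-connected: any two vertices are joined by a
vertex-proper geodesic. -/
def StrongProperVertexConnected (G : SimpleGraph V) {k : ℕ} (c : V → Option (Fin k)) : Prop :=
  ∀ u v : V, ∃ p : G.Walk u v, G.IsGeodesic p ∧ IsVertexProper c p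

/-- The strong proper vertex-connection number of a (finite connected) graph: the smallest number
of colors that suffice to make it strong proper vertex-connected. -/
noncomputable def spvc (G : SimpleGraph V) : ℕ :=
  sInf {k : ℕ | ∃ c : V → Option (Fin k), G.StrongProperVertexConnected c}

end SimpleGraph

namespace SpvcExtremal

/-- The triangle. -/
def triangle : SimpleGraph (Fin 3) :=
  SimpleGraph.fromEdgeSet {s(0, 1), s(0, 2), s(1, 2)}

/-- The star with three leaves. -/
def claw : SimpleGraph (Fin 4) :=
  SimpleGraph.fromEdgeSet {s(0, 1), s(0, 2), s(0, 3)}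

/-- The cycle on four vertices. -/
def fourCycle : SimpleGraph (Fin 4) :=
  SimpleGraph.fromEdgeSet {s(0, 1), s(1, 2), s(2, 3), s(0, 3)}

/-- A triangle with one pendant vertex. -/
def paw : SimpleGraph (Fin 4) :=
  SimpleGraph.fromEdgeSet {s(0, 1), s(0, 2), s(1, 2), s(0, 3)}

/-- The complete graph on four vertices minus one edge. -/
def diamond : SimpleGraph (Fin 4) :=
  SimpleGraph.fromEdgeSet {s(0, 1), s(0, 2), s(1, 2), s(1, 3), s(2, 3)}

/-- The path on five vertices. -/
def fivePath : SimpleGraph (Fin 5) :=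
  SimpleGraph.fromEdgeSet {s(0, 1), s(1, 2), s(2, 3), s(3, 4)}

/-- The star with three leaves, one edge of which is subdivided once. -/
def fork : SimpleGraph (Fin 5) :=
  SimpleGraph.fromEdgeSet {s(0, 1), s(0, 2), s(0, 3), s(3, 4)}

/-- A triangle with one pendant vertex at each of two of its vertices. -/
def bull : SimpleGraph (Fin 5) :=
  SimpleGraph.fromEdgeSet {s(0, 1), s(0, 2), s(1, 2), s(0, 3), s(1, 4)}

/-- A triangle with a pendant path of length two at one vertex. -/
def lollipop : SimpleGraph (Fin 5) :=
  SimpleGraph.fromEdgeSet {s(0, 1), s(0, 2), s(1, 2), s(0, 3), s(3, 4)}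

/-- The cycle on four vertices with one pendant vertex. -/
def banner : SimpleGraph (Fin 5) :=
  SimpleGraph.fromEdgeSet {s(0, 1), s(1, 2), s(2, 3), s(0, 3), s(0, 4)}

/-- The diamond with a pendant vertex at a vertex of degree two. -/
def kite : SimpleGraph (Fin 5) :=
  SimpleGraph.fromEdgeSet {s(0, 1), s(0, 2), s(1, 2), s(1, 3), s(2, 3), s(3, 4)}

/-- A triangle with one pendant vertex at each of its vertices. -/
def net : SimpleGraph (Fin 6) :=
  SimpleGraph.fromEdgeSet {s(0, 1), s(0, 2), s(1, 2), s(0, 3), s(1, 4), s(2, 5)}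

end SpvcExtremal

/-!
# Graphs of order `n` with strong proper vertex-connection number `n - 3`

Two principles bound the number of colors from above. First, if a set `T` of vertices meets the
common neighborhood of every pair at distance two, then the internal vertices of any geodesic can be
moved into `T` one by one, so a proper coloring of `G[T]` suffices (`spvc_le_card_of_cover`). The
middle vertex of a pair at distance two is never *simplicial* (its neighborhood is not a clique), so
`T` may be the set `P` of the vertices that are not simplicial. Second, a total coloring only has to
be checked on *distant* pairs, those at distance at least three (`spvc_le_of_distant`).

Let `n ≥ 6`. If two vertices `x, y` of `P` are distant, take nonadjacent neighbors `b, b'` of `x` and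
`c, c'` of `y`: the independent sets `{x, c, c'}` and `{y, b, b'}` need one color each, which saves
four colors. Otherwise each distant pair contains a simplicial vertex. Four simplicial vertices save
four colors, as they need none. With at most three of them, colors are saved by nonadjacent pairs in
`P`, and if there are too few such pairs then `P` is a clique, or nearly one, and the distant pairs
can be joined explicitly with two colors (with three colors if `n ≥ 7`), except in the net. So
`spvc G ≤ n - 4` unless `G` is the net (`spvc_add_four_le_or_net`).

For `n ≤ 5` the value `n - 3` is at most two. Values zero and one mean that `G` is complete and that
`G` has diameter two, and a graph of order five has value two exactly when it has a distant pair,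
that is, when it is an induced path on four vertices with a fifth vertex that leaves its ends at
distance three.
-/

namespace SimpleGraph

variable {V : Type*} {G : SimpleGraph V}

/-! ### Geodesics and distant pairs -/

/-- `G.Distant u v` says that `u` and `v` are distinct, nonadjacent and without a common neighbor;
in a connected graph this means that their distance is at least three. -/
def Distant (G : SimpleGraph V) (u v : V) : Prop :=
  u ≠ v ∧ ¬ G.Adj u v ∧ ∀ w, G.Adj u w → ¬ G.Adj w v

theorem Distant.symm {u v : V} (h : G.Distant u v) : G.Distant v u :=
  ⟨h.1.symm, fun h' => h.2.1 h'.symm, fun w h₁ h₂ => h.2.2 w h₂.symm h₁.symm⟩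

theorem exists_adj_adj_of_not_distant {u v : V} (h : ¬ G.Distant u v) (huv : u ≠ v)
    (hn : ¬ G.Adj u v) : ∃ w, G.Adj u w ∧ G.Adj w v := by
  by_contra hcon
  exact h ⟨huv, hn, fun w h₁ h₂ => hcon ⟨w, h₁, h₂⟩⟩

theorem Distant.three_le_length {u v : V} (h : G.Distant u v) (p : G.Walk u v) :
    3 ≤ p.length := by
  obtain ⟨h₁, h₂, h₃⟩ := h
  match p with
  | .nil => exact absurd rfl h₁
  | .cons a .nil => exact absurd a h₂
  | .cons a (.cons b .nil) => exact absurd b (h₃ _ a)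
  | .cons _ (.cons _ (.cons _ _)) => simp [Walk.length_cons]

theorem Distant.four_le_length {u v : V} (h : G.Distant u v)
    (hno : ∀ x y, G.Adj u x → G.Adj x y → ¬ G.Adj y v) (p : G.Walk u v) : 4 ≤ p.length := by
  obtain ⟨h₁, h₂, h₃⟩ := h
  match p with
  | .nil => exact absurd rfl h₁
  | .cons a .nil => exact absurd a h₂
  | .cons a (.cons b .nil) => exact absurd b (h₃ _ a)
  | .cons a (.cons b (.cons d .nil)) => exact absurd d (hno _ _ a b)
  | .cons _ (.cons _ (.cons _ (.cons _ _))) => simp [Walk.length_cons]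

theorem two_le_length_of_not_adj {u v : V} (h₁ : u ≠ v) (h₂ : ¬ G.Adj u v) (p : G.Walk u v) :
    2 ≤ p.length := by
  match p with
  | .nil => exact absurd rfl h₁
  | .cons a .nil => exact absurd a h₂
  | .cons _ (.cons _ _) => simp [Walk.length_cons]

/-- The first four vertices of a geodesic between distant vertices again form a geodesic, so some
vertex is at distance exactly three from `u`. -/
theorem Distant.exists_distant_of_path (hG : G.Connected) {u v : V} (h : G.Distant u v) :
    ∃ x y z, G.Adj u x ∧ G.Adj x y ∧ G.Adj y z ∧ G.Distant u z := by
  obtain ⟨p, hp⟩ := hG.exists_walk_length_eq_dist u v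
  have h3 := h.three_le_length p
  match p with
  | .nil => simp at h3
  | .cons _ .nil => simp at h3
  | .cons _ (.cons _ .nil) => simp at h3
  | .cons (v := x) hx (.cons (v := y) hy (.cons (v := z) hz q)) =>
    simp only [Walk.length_cons] at hp
    refine ⟨x, y, z, hx, hy, hz, ?_, fun h₁ => ?_, fun w h₁ h₂ => ?_⟩
    · rintro rfl
      have := dist_le q
      omega
    · have := dist_le (Walk.cons h₁ q)
      simp only [Walk.length_cons] at this
      omega
    · have := dist_le (Walk.cons h₁ (Walk.cons h₂ q))
      simp only [Walk.length_cons] at this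
      omega

theorem isGeodesic_of_length_le {u v : V} (p : G.Walk u v)
    (h : ∀ q : G.Walk u v, p.length ≤ q.length) : G.IsGeodesic p := by
  obtain ⟨q, hq⟩ := p.reachable.exists_walk_length_eq_dist
  have : p.length = G.dist u v := le_antisymm (hq ▸ h q) (dist_le p)
  exact ⟨p.isPath_of_length_eq_dist this, this⟩

/-! ### Upper and lower bounds from colorings -/

theorem StrongProperVertexConnected.spvc_le {k : ℕ} {c : V → Option (Fin k)}
    (hc : G.StrongProperVertexConnected c) : G.spvc ≤ k :=
  Nat.sInf_le ⟨c, hc⟩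

/-- If every two vertices at distance two have a common neighbor in `T`, then every two vertices
are joined by a geodesic whose internal vertices all lie in `T`: the internal vertices can be
moved into `T` one after the other. -/
theorem exists_geodesic_internal_mem (hG : G.Connected) (T : Set V)
    (hT : ∀ u v w, u ≠ v → ¬ G.Adj u v → G.Adj u w → G.Adj w v →
      ∃ t ∈ T, G.Adj u t ∧ G.Adj t v) (n : ℕ) :
    ∀ u v, G.dist u v = n → ∃ p : G.Walk u v, p.length = G.dist u v ∧
      ∀ i, 0 < i → i < p.length → p.getVert i ∈ T := by
  induction n with
  | zero =>
    intro u v h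
    obtain rfl := (hG.dist_eq_zero_iff).1 h
    exact ⟨.nil, by simp, by simp⟩
  | succ n ih =>
    intro u v h
    obtain ⟨p, hp⟩ := hG.exists_walk_length_eq_dist u v
    match p with
    | .nil => simp at h
    | .cons a .nil => exact ⟨.cons a .nil, hp, by simp; omega⟩
    | .cons (v := x) a (.cons (v := y) b q) =>
      have hl : q.length + 1 + 1 = G.dist u v := by simpa using hp
      have huy : u ≠ y := by
        rintro rfl
        have := dist_le q
        omega
      have hnadj : ¬ G.Adj u y := by
        intro h'
        have := dist_le (Walk.cons h' q)
        simp at this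
        omega
      obtain ⟨t, ht, hut, hty⟩ := hT u y x huy hnadj a b
      have htv : G.dist t v = n := by
        have h₁ := dist_le (Walk.cons hty q)
        obtain ⟨r, hr⟩ := hG.exists_walk_length_eq_dist t v
        have h₂ := dist_le (Walk.cons hut r)
        simp at h₁ h₂
        omega
      obtain ⟨r, hr, hrT⟩ := ih t v htv
      refine ⟨.cons hut r, by simp; omega, ?_⟩
      intro i hi hil
      obtain ⟨j, rfl⟩ : ∃ j, i = j + 1 := ⟨i - 1, by omega⟩
      rw [Walk.getVert_cons_succ]
      rcases Nat.eq_zero_or_pos j with rfl | hj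
      · simpa using ht
      · exact hrT j hj (by simpa using hil)

/-- Color only the vertices of a set `T` that meets the common neighborhood of every pair at
distance two, and color them properly: this makes the graph strong proper vertex-connected. The
coloring is given as a map `f` into an arbitrary type whose values on `T` lie in the finite
set `I` of colors. -/
theorem spvc_le_card_of_cover {α : Type*} (hG : G.Connected) (T : Set V) (f : V → α)
    (I : Finset α) (hI : ∀ x ∈ T, f x ∈ I)
    (hT : ∀ u v w, u ≠ v → ¬ G.Adj u v → G.Adj u w → G.Adj w v →
      ∃ t ∈ T, G.Adj u t ∧ G.Adj t v)
    (hf : ∀ x ∈ T, ∀ y ∈ T, G.Adj x y → f x ≠ f y) : G.spvc ≤ I.card := by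
  classical
  let c : V → Option (Fin I.card) := fun x =>
    if h : x ∈ T then some (I.equivFin ⟨f x, hI x h⟩) else none
  refine StrongProperVertexConnected.spvc_le (c := c) fun u v => ?_
  obtain ⟨p, hp, hpT⟩ := exists_geodesic_internal_mem hG T hT _ u v rfl
  refine ⟨p, ⟨p.isPath_of_length_eq_dist hp, hp⟩, fun i h₀ h₁ => ?_, fun i h₀ h₁ => ?_⟩
  · simp [c, hpT i h₀ h₁]
  · have hi := hpT i h₀ (by omega)
    have hi' := hpT (i + 1) (by omega) h₁
    have := hf _ hi _ hi' (p.adj_getVert_succ (by omega))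
    simpa [c, hi, hi'] using this

/-- The coloring `c` gives different colors to adjacent internal vertices of some path of length
three between `u` and `v` or, if there is no path of length three, of some path of length four. -/
def ProperlyJoined (G : SimpleGraph V) {α : Type*} (c : V → α) (u v : V) : Prop :=
  (∃ x y, G.Adj u x ∧ G.Adj x y ∧ G.Adj y v ∧ c x ≠ c y) ∨
    ((∀ x y, G.Adj u x → G.Adj x y → ¬ G.Adj y v) ∧
      ∃ x y z, G.Adj u x ∧ G.Adj x y ∧ G.Adj y z ∧ G.Adj z v ∧ c x ≠ c y ∧ c y ≠ c z)

theorem ProperlyJoined.symm {α : Type*} {c : V → α} {u v : V} (h : G.ProperlyJoined c u v) :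
    G.ProperlyJoined c v u := by
  rcases h with ⟨x, y, hx, hxy, hy, h⟩ | ⟨hno, x, y, z, hx, hxy, hyz, hz, h, h'⟩
  · exact Or.inl ⟨y, x, hy.symm, hxy.symm, hx.symm, h.symm⟩
  · exact Or.inr ⟨fun a b h₁ h₂ h₃ => hno b a h₃.symm h₂.symm h₁.symm,
      z, y, x, hz.symm, hyz.symm, hxy.symm, hx.symm, h'.symm, h.symm⟩

theorem spvc_le_of_distant {k : ℕ} (c : V → Fin k)
    (h : ∀ u v, G.Distant u v → G.ProperlyJoined c u v) : G.spvc ≤ k := by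
  refine StrongProperVertexConnected.spvc_le (c := fun x => some (c x)) fun u v => ?_
  by_cases hd : G.Distant u v
  · rcases h u v hd with ⟨x, y, hx, hxy, hy, hc⟩ | ⟨hno, x, y, z, hx, hxy, hyz, hz, hc, hc'⟩
    · refine ⟨.cons hx (.cons hxy (.cons hy .nil)),
        isGeodesic_of_length_le _ fun q => hd.three_le_length q, by simp, ?_⟩
      intro i h₀ h₁
      obtain rfl : i = 1 := by simp at h₁; omega
      simpa using hc
    · refine ⟨.cons hx (.cons hxy (.cons hyz (.cons hz .nil))),
        isGeodesic_of_length_le _ fun q => hd.four_le_length hno q, by simp, ?_⟩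
      intro i h₀ h₁
      have : i = 1 ∨ i = 2 := by simp at h₁; omega
      rcases this with rfl | rfl
      · simpa using hc
      · simpa using hc'
  · by_cases huv : u = v
    · subst huv
      exact ⟨.nil, isGeodesic_of_length_le _ (by simp), by simp, by simp⟩
    by_cases ha : G.Adj u v
    · refine ⟨.cons ha .nil, isGeodesic_of_length_le _ fun q => ?_, by simp, by simp⟩
      cases q with
      | nil => exact absurd rfl huv
      | cons _ _ => simp
    · obtain ⟨w, hw, hw'⟩ := exists_adj_adj_of_not_distant hd huv ha
      refine ⟨.cons hw (.cons hw' .nil), isGeodesic_of_length_le _ fun q =>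
        two_le_length_of_not_adj huv ha q, by simp, by simp; omega⟩

theorem spvc_eq_zero_of_forall_adj (h : ∀ u v, u ≠ v → G.Adj u v) : G.spvc = 0 := by
  refine Nat.le_zero.1 (StrongProperVertexConnected.spvc_le (c := fun _ => none) fun u v => ?_)
  rcases eq_or_ne u v with rfl | huv
  · exact ⟨.nil, isGeodesic_of_length_le _ (by simp), by simp [IsVertexProper]⟩
  · refine ⟨.cons (h u v huv) .nil, isGeodesic_of_length_le _ fun q => ?_,
      by simp; omega, by simp⟩
    cases q with
    | nil => exact absurd rfl huv
    | cons _ _ => simp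

theorem spvc_le_one_of_forall_not_distant (h : ∀ u v, ¬ G.Distant u v) :
    G.spvc ≤ 1 :=
  spvc_le_of_distant (fun _ => 0) fun u v huv => absurd huv (h u v)

theorem exists_strongProperVertexConnected_spvc [Fintype V] (hG : G.Connected) :
    ∃ c : V → Option (Fin G.spvc), G.StrongProperVertexConnected c := by
  refine Nat.sInf_mem (s := {k | ∃ c : V → Option (Fin k), G.StrongProperVertexConnected c})
    ⟨Fintype.card V, fun x => some (Fintype.equivFin V x), fun u v => ?_⟩
  obtain ⟨p, hp⟩ := hG.exists_walk_length_eq_dist u v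
  refine ⟨p, ⟨p.isPath_of_length_eq_dist hp, hp⟩, by simp, fun i h₀ h₁ => ?_⟩
  simpa using (p.adj_getVert_succ (i := i) (by omega)).ne

theorem one_le_spvc_of_not_adj [Fintype V] (hG : G.Connected) {u v : V} (huv : u ≠ v)
    (h : ¬ G.Adj u v) : 1 ≤ G.spvc := by
  obtain ⟨c, hc⟩ := exists_strongProperVertexConnected_spvc hG
  obtain ⟨p, -, hp, -⟩ := hc u v
  match p with
  | .nil => exact absurd rfl huv
  | .cons a .nil => exact absurd a h
  | .cons a (.cons b q) =>
    have := hp 1 one_pos (by simp)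
    obtain ⟨i, -⟩ := Option.ne_none_iff_exists'.1 this
    exact i.pos

theorem two_le_spvc_of_distant [Fintype V] (hG : G.Connected) {u v : V}
    (h : G.Distant u v) : 2 ≤ G.spvc := by
  obtain ⟨c, hc⟩ := exists_strongProperVertexConnected_spvc hG
  obtain ⟨p, -, hp, hp'⟩ := hc u v
  have h3 := h.three_le_length p
  obtain ⟨i, hi⟩ := Option.ne_none_iff_exists'.1 (hp 1 one_pos (by omega))
  obtain ⟨j, hj⟩ := Option.ne_none_iff_exists'.1 (hp 2 two_pos (by omega))
  have hij : c (p.getVert 1) ≠ c (p.getVert 2) := hp' 1 one_pos (by omega)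
  have : i ≠ j := by
    rintro rfl
    exact hij (hi.trans hj.symm)
  have := Fin.val_ne_of_ne this
  omega

/-- Two vertices at distance three, which the path `u, x, y, v` witnesses, are joined by a path of
length three whose two internal vertices have different colors. -/
theorem StrongProperVertexConnected.exists_ne_of_distant {k : ℕ} {c : V → Option (Fin k)}
    (hc : G.StrongProperVertexConnected c) {u v x y : V} (h : G.Distant u v)
    (hx : G.Adj u x) (hxy : G.Adj x y) (hy : G.Adj y v) :
    ∃ x y, G.Adj u x ∧ G.Adj x y ∧ G.Adj y v ∧ c x ≠ none ∧ c y ≠ none ∧ c x ≠ c y := by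
  obtain ⟨p, hg, hp, hp'⟩ := hc u v
  have h3 := h.three_le_length p
  have hl : p.length ≤ 3 := hg.2 ▸ dist_le (.cons hx (.cons hxy (.cons hy .nil)))
  have hl : p.length = 3 := le_antisymm hl h3
  refine ⟨p.getVert 1, p.getVert 2, ?_, p.adj_getVert_succ (by omega), ?_, hp 1 one_pos (by omega),
    hp 2 two_pos (by omega), hp' 1 one_pos (by omega)⟩
  · simpa using p.adj_getVert_succ (i := 0) (by omega)
  · have := p.adj_getVert_succ (i := 2) (by omega)
    rwa [show 2 + 1 = p.length by omega, p.getVert_length] at this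

/-! ### Invariance under isomorphism -/

theorem StrongProperVertexConnected.comp_symm {W : Type*} {H : SimpleGraph W} (e : G ≃g H)
    {k : ℕ} {c : V → Option (Fin k)} (hc : G.StrongProperVertexConnected c) :
    H.StrongProperVertexConnected fun w => c (e.symm w) := by
  intro u v
  obtain ⟨u, rfl⟩ := e.surjective u
  obtain ⟨v, rfl⟩ := e.surjective v
  obtain ⟨p, hg, hp⟩ := hc u v
  refine ⟨p.map e.toHom, isGeodesic_of_length_le _ fun q => ?_, ?_⟩
  · have := dist_le ((q.map e.symm.toHom).copy (e.symm_apply_apply u) (e.symm_apply_apply v))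
    rw [Walk.length_copy, Walk.length_map] at this
    rw [Walk.length_map, hg.2]
    exact this
  · simpa [IsVertexProper] using hp

theorem spvc_congr {W : Type*} {H : SimpleGraph W} (e : G ≃g H) : G.spvc = H.spvc := by
  unfold spvc
  congr 1
  ext k
  refine ⟨fun ⟨c, hc⟩ => ⟨_, hc.comp_symm e⟩, fun ⟨c, hc⟩ => ⟨_, hc.comp_symm e.symm⟩⟩

/-! ### The twelve graphs -/

/-- An enumeration `f` of as many distinct vertices of `G` as `G` has, with the adjacencies of a
graph `H` on `Fin n`, is an isomorphism. -/
theorem nonempty_iso_of_enumeration [Fintype V] {n : ℕ} (hn : Fintype.card V = n)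
    (H : SimpleGraph (Fin n)) (f : Fin n → V) (hf : Function.Injective f)
    (h : ∀ i j, G.Adj (f i) (f j) ↔ H.Adj i j) : Nonempty (G ≃g H) := by
  have hb : Function.Bijective f :=
    (Fintype.bijective_iff_injective_and_card f).2 ⟨hf, by simp [hn]⟩
  exact ⟨(RelIso.mk (Equiv.ofBijective f hb) (fun {i j} => h i j) : H ≃g G).symm⟩

/-- Adjacencies and distinctness need only be checked on pairs `i < j`. -/
theorem nonempty_iso_of_lt [Fintype V] {n : ℕ} (hn : Fintype.card V = n)
    (H : SimpleGraph (Fin n)) (f : Fin n → V)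
    (h : ∀ i j, i < j → f i ≠ f j ∧ (G.Adj (f i) (f j) ↔ H.Adj i j)) : Nonempty (G ≃g H) := by
  refine nonempty_iso_of_enumeration hn H f (fun i j hij => ?_) fun i j => ?_
  · rcases lt_trichotomy i j with hlt | rfl | hlt
    · exact absurd hij (h i j hlt).1
    · rfl
    · exact absurd hij.symm (h j i hlt).1
  · rcases lt_trichotomy i j with hlt | rfl | hlt
    · exact (h i j hlt).2
    · simp
    · rw [G.adj_comm, H.adj_comm]
      exact (h j i hlt).2

end SimpleGraph

namespace SpvcExtremal

open SimpleGraph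

instance : DecidableRel triangle.Adj := inferInstanceAs (DecidableRel (fromEdgeSet _).Adj)

instance : DecidableRel claw.Adj := inferInstanceAs (DecidableRel (fromEdgeSet _).Adj)

instance : DecidableRel fourCycle.Adj := inferInstanceAs (DecidableRel (fromEdgeSet _).Adj)

instance : DecidableRel paw.Adj := inferInstanceAs (DecidableRel (fromEdgeSet _).Adj)

instance : DecidableRel diamond.Adj := inferInstanceAs (DecidableRel (fromEdgeSet _).Adj)

instance : DecidableRel fivePath.Adj := inferInstanceAs (DecidableRel (fromEdgeSet _).Adj)

instance : DecidableRel fork.Adj := inferInstanceAs (DecidableRel (fromEdgeSet _).Adj)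

instance : DecidableRel bull.Adj := inferInstanceAs (DecidableRel (fromEdgeSet _).Adj)

instance : DecidableRel lollipop.Adj := inferInstanceAs (DecidableRel (fromEdgeSet _).Adj)

instance : DecidableRel banner.Adj := inferInstanceAs (DecidableRel (fromEdgeSet _).Adj)

instance : DecidableRel kite.Adj := inferInstanceAs (DecidableRel (fromEdgeSet _).Adj)

instance : DecidableRel net.Adj := inferInstanceAs (DecidableRel (fromEdgeSet _).Adj)

theorem card_eq_of_iso {V : Type*} [Fintype V] {G : SimpleGraph V} {n : ℕ}
    {H : SimpleGraph (Fin n)} (e : G ≃g H) : Fintype.card V = n := by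
  simpa using Fintype.card_congr e.toEquiv

theorem spvc_triangle : triangle.spvc = 0 :=
  spvc_eq_zero_of_forall_adj (by decide)

theorem spvc_eq_one {V : Type*} [Fintype V] {G : SimpleGraph V} (hG : G.Connected) {u v : V}
    (huv : u ≠ v) (h : ¬ G.Adj u v) (hd : ∀ u v, ¬ G.Distant u v) : G.spvc = 1 :=
  le_antisymm (spvc_le_one_of_forall_not_distant hd) (one_le_spvc_of_not_adj hG huv h)

theorem spvc_claw (hG : claw.Connected) : claw.spvc = 1 :=
  spvc_eq_one hG (u := 1) (v := 2) (by decide) (by decide)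
    (by unfold Distant; decide)

theorem spvc_fourCycle (hG : fourCycle.Connected) : fourCycle.spvc = 1 :=
  spvc_eq_one hG (u := 0) (v := 2) (by decide) (by decide)
    (by unfold Distant; decide)

theorem spvc_paw (hG : paw.Connected) : paw.spvc = 1 :=
  spvc_eq_one hG (u := 1) (v := 3) (by decide) (by decide)
    (by unfold Distant; decide)

theorem spvc_diamond (hG : diamond.Connected) : diamond.spvc = 1 :=
  spvc_eq_one hG (u := 0) (v := 3) (by decide) (by decide)
    (by unfold Distant; decide)

/-- A graph with a distant pair has strong proper vertex-connection number two if two colors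
suffice for a properly colored set `T` (the vertices whose color is not `none`) that meets all
common neighborhoods of pairs at distance two. -/
theorem spvc_eq_two {V : Type*} [Fintype V] {G : SimpleGraph V} (hG : G.Connected) {u v : V}
    (hd : G.Distant u v) (f : V → Option (Fin 2))
    (hT : ∀ u v w, u ≠ v → ¬ G.Adj u v → G.Adj u w → G.Adj w v →
      ∃ t, f t ≠ none ∧ G.Adj u t ∧ G.Adj t v)
    (hf : ∀ x y, f x ≠ none → G.Adj x y → f x ≠ f y) : G.spvc = 2 := by
  refine le_antisymm ?_ (two_le_spvc_of_distant hG hd)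
  exact spvc_le_card_of_cover hG {x | f x ≠ none} f {some 0, some 1}
    (fun x hx => by
      obtain ⟨i, hi⟩ := Option.ne_none_iff_exists'.1 hx
      rw [hi]
      fin_cases i <;> simp)
    hT fun x hx y _ => hf x y hx

theorem spvc_fivePath (hG : fivePath.Connected) : fivePath.spvc = 2 :=
  spvc_eq_two hG (u := 0) (v := 3) (by unfold Distant; decide)
    ![none, some 0, some 1, some 0, none] (by decide) (by decide)

theorem spvc_fork (hG : fork.Connected) : fork.spvc = 2 :=
  spvc_eq_two hG (u := 1) (v := 4) (by unfold Distant; decide)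
    ![some 0, none, none, some 1, none] (by decide) (by decide)

theorem spvc_bull (hG : bull.Connected) : bull.spvc = 2 :=
  spvc_eq_two hG (u := 3) (v := 4) (by unfold Distant; decide)
    ![some 0, some 1, none, none, none] (by decide) (by decide)

theorem spvc_lollipop (hG : lollipop.Connected) : lollipop.spvc = 2 :=
  spvc_eq_two hG (u := 1) (v := 4) (by unfold Distant; decide)
    ![some 0, none, none, some 1, none] (by decide) (by decide)

theorem spvc_banner (hG : banner.Connected) : banner.spvc = 2 :=
  spvc_eq_two hG (u := 2) (v := 4) (by unfold Distant; decide)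
    ![some 0, some 1, none, none, none] (by decide) (by decide)

theorem spvc_kite (hG : kite.Connected) : kite.spvc = 2 :=
  spvc_eq_two hG (u := 0) (v := 4) (by unfold Distant; decide)
    ![none, some 0, none, some 1, none] (by decide) (by decide)

/-- Each of the three pairs of pendant vertices of the net is joined by a unique geodesic, so the
three vertices of the triangle get three different colors. -/
theorem spvc_net (hG : net.Connected) : net.spvc = 3 := by
  refine le_antisymm ?_ ?_
  · exact spvc_le_card_of_cover hG {x | x < 3} (fun x => x) {0, 1, 2}
      (by decide) (by decide) (by decide)
  · obtain ⟨c, hc⟩ := exists_strongProperVertexConnected_spvc hG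
    have key : ∀ u v a b : Fin 6, net.Distant u v → net.Adj u a → net.Adj a b → net.Adj b v →
        (∀ x y, net.Adj u x → net.Adj y v → x = a ∧ y = b) →
        c a ≠ none ∧ c b ≠ none ∧ c a ≠ c b := by
      intro u v a b hd h₁ h₂ h₃ huniq
      obtain ⟨x, y, hx, -, hy, h⟩ := hc.exists_ne_of_distant hd h₁ h₂ h₃
      obtain ⟨rfl, rfl⟩ := huniq x y hx hy
      exact h
    obtain ⟨h0, h1, h01⟩ := key 3 4 0 1 (by unfold Distant; decide) (by decide)
      (by decide) (by decide) (by decide)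
    obtain ⟨-, h2, h02⟩ := key 3 5 0 2 (by unfold Distant; decide) (by decide)
      (by decide) (by decide) (by decide)
    obtain ⟨-, -, h12⟩ := key 4 5 1 2 (by unfold Distant; decide) (by decide)
      (by decide) (by decide) (by decide)
    obtain ⟨i, hi⟩ := Option.ne_none_iff_exists'.1 h0
    obtain ⟨j, hj⟩ := Option.ne_none_iff_exists'.1 h1
    obtain ⟨l, hl⟩ := Option.ne_none_iff_exists'.1 h2
    rw [hi, hj] at h01
    rw [hi, hl] at h02
    rw [hj, hl] at h12
    have hij : i ≠ j := fun h => h01 (congrArg some h)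
    have hil : i ≠ l := fun h => h02 (congrArg some h)
    have hjl : j ≠ l := fun h => h12 (congrArg some h)
    omega

end SpvcExtremal

namespace SimpleGraph

variable {V : Type*} {G : SimpleGraph V}

/-! ### Simplicial vertices -/

/-- A vertex is simplicial if its neighbors are pairwise adjacent. Such a vertex is never an
internal vertex of a geodesic. -/
def IsSimplicialVertex (G : SimpleGraph V) (v : V) : Prop :=
  ∀ x y, G.Adj v x → G.Adj v y → x ≠ y → G.Adj x y

theorem exists_not_adj_of_not_isSimplicialVertex {v : V} (h : ¬ G.IsSimplicialVertex v) :
    ∃ x y, G.Adj v x ∧ G.Adj v y ∧ x ≠ y ∧ ¬ G.Adj x y := by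
  simpa [IsSimplicialVertex] using h

/-- On a path of length two with nonadjacent ends, the middle vertex is not simplicial. -/
theorem not_isSimplicialVertex_of_adj {u v w : V} (huv : u ≠ v) (h : ¬ G.Adj u v)
    (hu : G.Adj u w) (hv : G.Adj w v) : ¬ G.IsSimplicialVertex w :=
  fun hw => h (hw u v hu.symm hv huv)

/-- In a connected graph that is not complete, each simplicial vertex has a neighbor that is not
simplicial: the second vertex of a geodesic to a vertex that is not simplicial. -/
theorem exists_adj_not_isSimplicialVertex (hG : G.Connected) {a p : V}
    (ha : G.IsSimplicialVertex a) (hp : ¬ G.IsSimplicialVertex p) :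
    ∃ b, G.Adj a b ∧ ¬ G.IsSimplicialVertex b := by
  obtain ⟨q, hq⟩ := hG.exists_walk_length_eq_dist a p
  match q with
  | .nil => exact absurd ha hp
  | .cons h .nil => exact ⟨_, h, hp⟩
  | .cons (v := x) h (.cons (v := y) h' r) =>
    refine ⟨x, h, not_isSimplicialVertex_of_adj ?_ ?_ h h'⟩
    · rintro rfl
      have := dist_le r
      simp at hq
      omega
    · intro h''
      have := dist_le (Walk.cons h'' r)
      simp at hq this
      omega

/-- A proper coloring of the vertices that are not simplicial suffices. The colors are taken to be
vertices of `G`, so that each vertex of `B`, none of which is used as a color, saves one color. -/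
theorem spvc_add_card_le_of_not_isSimplicialVertex [Fintype V] (hG : G.Connected) (f : V → V)
    (B : Finset V) (hB : ∀ x, ¬ G.IsSimplicialVertex x → f x ∉ B)
    (hf : ∀ x y, ¬ G.IsSimplicialVertex x → ¬ G.IsSimplicialVertex y → G.Adj x y → f x ≠ f y) :
    G.spvc + B.card ≤ Fintype.card V := by
  classical
  have h := spvc_le_card_of_cover hG {x | ¬ G.IsSimplicialVertex x} f Bᶜ
    (fun x hx => Finset.mem_compl.2 (hB x hx))
    (fun u v w huv h hu hv => ⟨w, not_isSimplicialVertex_of_adj huv h hu hv, hu, hv⟩)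
    (fun x hx y hy => hf x y hx hy)
  have := Finset.card_compl_add_card B
  omega

/-! ### Graphs of order at least six -/

/-- If `x` and `y` are distant and neither is simplicial, with nonadjacent neighbors `b, b'` of `x`
and `c, c'` of `y`, then `{x, c, c'}` and `{y, b, b'}` are disjoint independent sets, and each can be
given a single color. -/
theorem spvc_add_four_le_of_distant [Fintype V] (hG : G.Connected) {x y : V}
    (h : G.Distant x y) (hx : ¬ G.IsSimplicialVertex x) (hy : ¬ G.IsSimplicialVertex y) :
    G.spvc + 4 ≤ Fintype.card V := by
  classical
  obtain ⟨b, b', hb, hb', hbb, hnb⟩ := exists_not_adj_of_not_isSimplicialVertex hx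
  obtain ⟨c, c', hc, hc', hcc, hnc⟩ := exists_not_adj_of_not_isSimplicialVertex hy
  obtain ⟨hxy, hnxy, hno⟩ := h
  have hn : ∀ w, G.Adj x w → ¬ G.Adj y w := fun w h₁ h₂ => hno w h₁ h₂.symm
  have hbx := hb.ne
  have hbx' := hb'.ne
  have hcy := hc.ne
  have hcy' := hc'.ne
  have hby : b ≠ y := by rintro rfl; exact hnxy hb
  have hby' : b' ≠ y := by rintro rfl; exact hnxy hb'
  have hcx : c ≠ x := by rintro rfl; exact hnxy hc.symm
  have hcx' : c' ≠ x := by rintro rfl; exact hnxy hc'.symm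
  have h₁ : b ≠ c := by rintro rfl; exact hn _ hb hc
  have h₂ : b ≠ c' := by rintro rfl; exact hn _ hb hc'
  have h₃ : b' ≠ c := by rintro rfl; exact hn _ hb' hc
  have h₄ : b' ≠ c' := by rintro rfl; exact hn _ hb' hc'
  have hcard : ({b, b', c, c'} : Finset V).card = 4 := by
    simp [Finset.card_insert_of_notMem, *]
  rw [← hcard]
  refine spvc_add_card_le_of_not_isSimplicialVertex hG
    (fun z => if z = c ∨ z = c' then x else if z = b ∨ z = b' then y else z) _ ?_ ?_
  · intro z _
    simp only [Finset.mem_insert, Finset.mem_singleton]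
    grind
  · intro u v _ _ huv
    have := hn b hb
    have := hn b' hb'
    have hc₁ : ¬ G.Adj x c := fun h => hn c h hc
    have hc₂ : ¬ G.Adj x c' := fun h => hn c' h hc'
    grind [G.adj_comm, G.irrefl]

/-- A graph in which no two nonadjacent pairs of vertices of `P` are disjoint and no three vertices
of `P` are independent becomes complete on `P` when one vertex is deleted: the complementary graph
has neither two disjoint edges nor a triangle on `P`, so it is a star there. -/
theorem exists_forall_adj_of_no_matching {P : Set V} (hP : P.Nonempty)
    (h₁ : ∀ x ∈ P, ∀ y ∈ P, ∀ u ∈ P, ∀ v ∈ P, x ≠ y → u ≠ v → ¬ G.Adj x y → ¬ G.Adj u v →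
      u = x ∨ u = y ∨ v = x ∨ v = y)
    (h₂ : ∀ x ∈ P, ∀ y ∈ P, ∀ z ∈ P, x ≠ y → x ≠ z → y ≠ z → ¬ G.Adj x y → ¬ G.Adj x z →
      G.Adj y z) :
    ∃ p ∈ P, ∀ x ∈ P, ∀ y ∈ P, x ≠ p → y ≠ p → x ≠ y → G.Adj x y := by
  by_contra! hcon
  obtain ⟨p, hp⟩ := hP
  obtain ⟨x, hx, y, hy, -, -, hxy, hnxy⟩ := hcon p hp
  obtain ⟨u, hu, v, hv, hux, hvx, huv, hnuv⟩ := hcon x hx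
  obtain ⟨u', hu', v', hv', huy, hvy, huv', hnuv'⟩ := hcon y hy
  -- The nonadjacent pair avoiding `x` meets `{x, y}`, hence contains `y`; likewise for `y`.
  obtain ⟨w, hw, hwx, hwy, hnw⟩ : ∃ w ∈ P, w ≠ x ∧ y ≠ w ∧ ¬ G.Adj y w := by
    rcases h₁ x hx y hy u hu v hv hxy huv hnxy hnuv with h | h | h | h
    · exact absurd h hux
    · exact ⟨v, hv, hvx, h ▸ huv, h ▸ hnuv⟩
    · exact absurd h hvx
    · exact ⟨u, hu, hux, h ▸ huv.symm, fun h' => hnuv (h ▸ h'.symm)⟩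
  obtain ⟨w', hw', hwx', hwy', hnw'⟩ : ∃ w ∈ P, w ≠ y ∧ x ≠ w ∧ ¬ G.Adj x w := by
    rcases h₁ x hx y hy u' hu' v' hv' hxy huv' hnxy hnuv' with h | h | h | h
    · exact ⟨v', hv', hvy, h ▸ huv', h ▸ hnuv'⟩
    · exact absurd h huy
    · exact ⟨u', hu', huy, h ▸ huv'.symm, fun h' => hnuv' (h ▸ h'.symm)⟩
    · exact absurd h hvy
  rcases h₁ y hy w hw x hx w' hw' hwy hwy' hnw hnw' with h | h | h | h
  · exact hxy h
  · exact hwx h.symm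
  · exact hwx' h
  · subst h
    exact hnw (h₂ x hx y hy w' hw' hxy hwy' hwy hnxy hnw')

/-- If every distant pair contains a simplicial vertex, only pairs whose first vertex is simplicial
need to be considered. -/
theorem spvc_le_of_distant_of_isSimplicialVertex {k : ℕ} (c : V → Fin k)
    (hd : ∀ x y, G.Distant x y → G.IsSimplicialVertex x ∨ G.IsSimplicialVertex y)
    (h : ∀ u v, G.IsSimplicialVertex u → G.Distant u v → G.ProperlyJoined c u v) :
    G.spvc ≤ k := by
  refine spvc_le_of_distant c fun u v huv => ?_
  rcases hd u v huv with hu | hv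
  · exact h u v hu huv
  · exact (h v u hv huv.symm).symm

/-- The case of two simplicial vertices `a₁` and `a₂` where the other vertices form a clique after
the deletion of a neighbor `p` of `a₁`. If `a₂` is at distance at most two from `p`, it suffices to
give `p` a color of its own; otherwise `p` shares that color with the neighbors of `a₂`. -/
theorem spvc_le_two_of_two_simplicial_of_adj (hG : G.Connected) {a₁ a₂ p : V}
    (hS : ∀ x, G.IsSimplicialVertex x ↔ x = a₁ ∨ x = a₂)
    (hd : ∀ x y, G.Distant x y → G.IsSimplicialVertex x ∨ G.IsSimplicialVertex y)
    (hp : ¬ G.IsSimplicialVertex p)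
    (hclique : ∀ x y, ¬ G.IsSimplicialVertex x → ¬ G.IsSimplicialVertex y → x ≠ p → y ≠ p →
      x ≠ y → G.Adj x y) (hap : G.Adj a₁ p) : G.spvc ≤ 2 := by
  classical
  have ha₂ : G.IsSimplicialVertex a₂ := (hS a₂).2 (Or.inr rfl)
  -- A vertex that is far from a neighbor of `p` is reached from `p` in two steps.
  have hcommon : ∀ a y, G.Adj a p → ¬ G.IsSimplicialVertex y → G.Distant a y →
      ∃ z, G.Adj p z ∧ G.Adj z y := by
    intro a y ha hy hay
    refine exists_adj_adj_of_not_distant (fun h => (hd _ _ h).elim hp hy) ?_ (hay.2.2 p ha)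
    rintro rfl
    exact hay.2.1 ha
  obtain ⟨b, hb, hbP⟩ := exists_adj_not_isSimplicialVertex hG ha₂ hp
  have hclose : ∀ y, b ≠ p → ¬ G.IsSimplicialVertex y → y ≠ p → ¬ G.Distant a₂ y := by
    intro y hbp hy hyp h
    by_cases hby : b = y
    · subst hby
      exact h.2.1 hb
    · exact h.2.2 b hb (hclique b y hbP hy hbp hyp hby)
  have hcases : ∀ c : V → Fin 2, (G.Distant a₁ a₂ → G.ProperlyJoined c a₁ a₂) →
      (∀ y, ¬ G.IsSimplicialVertex y → G.Distant a₁ y → G.ProperlyJoined c a₁ y) →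
      (∀ y, ¬ G.IsSimplicialVertex y → G.Distant a₂ y → G.ProperlyJoined c a₂ y) →
      G.spvc ≤ 2 := by
    intro c h₁₂ h₁ h₂
    refine spvc_le_of_distant_of_isSimplicialVertex c hd fun u v hu huv => ?_
    by_cases hv : G.IsSimplicialVertex v
    · rcases (hS u).1 hu with rfl | rfl <;> rcases (hS v).1 hv with rfl | rfl
      · exact absurd rfl huv.1
      · exact h₁₂ huv
      · exact (h₁₂ huv.symm).symm
      · exact absurd rfl huv.1
    · rcases (hS u).1 hu with rfl | rfl
      · exact h₁ v hv huv
      · exact h₂ v hv huv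
  by_cases hH : G.Adj a₂ p ∨ ∃ x, G.Adj a₂ x ∧ G.Adj x p
  · refine hcases (fun x => if x = p then 1 else 0) (fun h => ?_) (fun y hy h => ?_)
      (fun y hy h => ?_)
    · rcases hH with h' | ⟨x, hx, hxp⟩
      · exact absurd h'.symm (h.2.2 p hap)
      · exact Or.inl ⟨p, x, hap, hxp.symm, hx.symm, by simp [hxp.ne]⟩
    · obtain ⟨z, hz, hzy⟩ := hcommon a₁ y hap hy h
      exact Or.inl ⟨p, z, hap, hz, hzy, by simp [hz.ne']⟩
    · by_cases h' : G.Adj a₂ p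
      · obtain ⟨z, hz, hzy⟩ := hcommon a₂ y h' hy h
        exact Or.inl ⟨p, z, h', hz, hzy, by simp [hz.ne']⟩
      · obtain ⟨x, hx, hxp⟩ := hH.resolve_left h'
        by_cases hyp : y = p
        · subst hyp
          exact absurd hxp (h.2.2 x hx)
        · exact absurd h (hclose y (by rintro rfl; exact h' hb) hy hyp)
  · push Not at hH
    obtain ⟨hH, hH'⟩ := hH
    have hbp : b ≠ p := by
      rintro rfl
      exact hH hb
    obtain ⟨z, hpz, hzb⟩ : ∃ z, G.Adj p z ∧ G.Adj z b :=
      exists_adj_adj_of_not_distant (fun h => (hd _ _ h).elim hp hbP) hbp.symm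
        fun h => hH' b hb h.symm
    -- No neighbor of `p` is a neighbor of `a₂`, so those neighbors all get the second color.
    have hcol : ∀ z, G.Adj p z → z ≠ p ∧ ¬ G.Adj a₂ z :=
      fun z hz => ⟨hz.ne', fun h => hH' z h hz.symm⟩
    have hz := hcol z hpz
    refine hcases (fun x => if x = p ∨ G.Adj a₂ x then 1 else 0) (fun h => ?_) (fun y hy h => ?_)
      (fun y hy h => ?_)
    · by_cases h3 : ∃ x y, G.Adj a₁ x ∧ G.Adj x y ∧ G.Adj y a₂
      · obtain ⟨x, y, hx, hxy, hy⟩ := h3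
        have hxp : x ≠ p := by
          rintro rfl
          exact hH' y hy.symm hxy.symm
        have hxa : ¬ G.Adj a₂ x := fun h' => h.2.2 x hx h'.symm
        exact Or.inl ⟨x, y, hx, hxy, hy, by simp [hxp, hxa, hy.symm]⟩
      · push Not at h3
        exact Or.inr ⟨h3, p, z, b, hap, hpz, hzb, hb.symm, by simp [hz], by simp [hz, hb]⟩
    · obtain ⟨w, hw, hwy⟩ := hcommon a₁ y hap hy h
      exact Or.inl ⟨p, w, hap, hw, hwy, by simp [hcol w hw]⟩
    · by_cases hyp : y = p
      · subst hyp
        exact Or.inl ⟨b, z, hb, hzb.symm, hpz.symm, by simp [hz, hb]⟩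
      · exact absurd h (hclose y hbp hy hyp)

/-- The case of two simplicial vertices `a₁` and `a₂` where the other vertices form a clique after
the deletion of a single vertex `p`: since `p` is not simplicial, `a₁` or `a₂` is a neighbor. -/
theorem spvc_le_two_of_two_simplicial (hG : G.Connected) {a₁ a₂ p : V}
    (hS : ∀ x, G.IsSimplicialVertex x ↔ x = a₁ ∨ x = a₂)
    (hd : ∀ x y, G.Distant x y → G.IsSimplicialVertex x ∨ G.IsSimplicialVertex y)
    (hp : ¬ G.IsSimplicialVertex p)
    (hclique : ∀ x y, ¬ G.IsSimplicialVertex x → ¬ G.IsSimplicialVertex y → x ≠ p → y ≠ p →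
      x ≠ y → G.Adj x y) : G.spvc ≤ 2 := by
  by_cases h₁ : G.Adj a₁ p
  · exact spvc_le_two_of_two_simplicial_of_adj hG hS hd hp hclique h₁
  by_cases h₂ : G.Adj a₂ p
  · exact spvc_le_two_of_two_simplicial_of_adj hG (fun x => (hS x).trans or_comm) hd hp hclique h₂
  obtain ⟨x, y, hx, hy, hxy, hn⟩ := exists_not_adj_of_not_isSimplicialVertex hp
  have hP : ∀ x, G.Adj p x → ¬ G.IsSimplicialVertex x := by
    intro x hx hxS
    rcases (hS x).1 hxS with rfl | rfl
    · exact h₁ hx.symm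
    · exact h₂ hx.symm
  exact absurd (hclique x y (hP x hx) (hP y hy) hx.ne' hy.ne' hxy) hn

/-- The case of a single simplicial vertex `a`: all distant pairs contain `a`, and it suffices to
color the neighbors of `a` differently from the other vertices. -/
theorem spvc_le_two_of_one_simplicial (hG : G.Connected) {a p : V}
    (hS : ∀ x, G.IsSimplicialVertex x ↔ x = a) (hp : ¬ G.IsSimplicialVertex p)
    (hd : ∀ x y, G.Distant x y → G.IsSimplicialVertex x ∨ G.IsSimplicialVertex y) :
    G.spvc ≤ 2 := by
  classical
  refine spvc_le_of_distant_of_isSimplicialVertex (fun x => if G.Adj a x then 1 else 0) hd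
    fun u v hu huv => ?_
  obtain rfl := (hS u).1 hu
  have hv : ¬ G.IsSimplicialVertex v := fun h => huv.1 ((hS v).1 h).symm
  obtain ⟨b, hb, hbP⟩ := exists_adj_not_isSimplicialVertex hG hu hp
  obtain ⟨z, hbz, hzv⟩ := exists_adj_adj_of_not_distant (fun h => (hd _ _ h).elim hbP hv)
    (by rintro rfl; exact huv.2.1 hb) (huv.2.2 b hb)
  have hz : ¬ G.Adj u z := fun h => huv.2.2 z h hzv
  exact Or.inl ⟨b, z, hb, hbz, hzv, by simp [hb, hz]⟩

/-- If the vertices that are not simplicial form a clique, only distant pairs of simplicial vertices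
matter, and they are joined through chosen neighbors `b i`. -/
theorem spvc_le_of_clique {k : ℕ} (c : V → Fin k) (b : V → V)
    (hb : ∀ a, G.IsSimplicialVertex a → G.Adj a (b a) ∧ ¬ G.IsSimplicialVertex (b a))
    (hclique : ∀ x y, ¬ G.IsSimplicialVertex x → ¬ G.IsSimplicialVertex y → x ≠ y → G.Adj x y)
    (hc : ∀ u v, G.IsSimplicialVertex u → G.IsSimplicialVertex v → b u ≠ b v →
      c (b u) ≠ c (b v)) : G.spvc ≤ k := by
  refine spvc_le_of_distant_of_isSimplicialVertex c ?_ fun u v hu huv => ?_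
  · intro x y h
    by_contra! hcon
    exact h.2.1 (hclique x y hcon.1 hcon.2 h.1)
  · obtain ⟨hbu, hbuP⟩ := hb u hu
    by_cases hv : G.IsSimplicialVertex v
    · obtain ⟨hbv, hbvP⟩ := hb v hv
      have hne : b u ≠ b v := by
        intro h
        exact huv.2.2 _ hbu (h ▸ hbv.symm)
      exact Or.inl ⟨b u, b v, hbu, hclique _ _ hbuP hbvP hne, hbv.symm, hc u v hu hv hne⟩
    · by_cases h : b u = v
      · exact absurd (h ▸ hbu) huv.2.1
      · exact absurd (hclique _ _ hbuP hv h) (huv.2.2 _ hbu)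

/-- The case of three simplicial vertices and a clique. If two of the simplicial vertices share a
neighbor in the clique, then two colors suffice; otherwise the graph is the net, or of order at least
seven, and three colors suffice. -/
theorem spvc_add_four_le_or_net_of_three_simplicial [Fintype V] (hG : G.Connected)
    (hn : 6 ≤ Fintype.card V) {a₁ a₂ a₃ p : V} (h₁₂ : a₁ ≠ a₂) (h₁₃ : a₁ ≠ a₃) (h₂₃ : a₂ ≠ a₃)
    (hS : ∀ x, G.IsSimplicialVertex x ↔ x = a₁ ∨ x = a₂ ∨ x = a₃)
    (hp : ¬ G.IsSimplicialVertex p)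
    (hclique : ∀ x y, ¬ G.IsSimplicialVertex x → ¬ G.IsSimplicialVertex y → x ≠ y → G.Adj x y) :
    G.spvc + 4 ≤ Fintype.card V ∨ Nonempty (G ≃g SpvcExtremal.net) := by
  classical
  have hex : ∀ a, ∃ b, G.IsSimplicialVertex a → G.Adj a b ∧ ¬ G.IsSimplicialVertex b := by
    intro a
    by_cases ha : G.IsSimplicialVertex a
    · obtain ⟨b, hb⟩ := exists_adj_not_isSimplicialVertex hG ha hp
      exact ⟨b, fun _ => hb⟩
    · exact ⟨a, fun h => absurd h ha⟩
  choose b hb using hex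
  by_cases hshare : ∃ i j w, G.IsSimplicialVertex i ∧ G.IsSimplicialVertex j ∧ i ≠ j ∧
      ¬ G.IsSimplicialVertex w ∧ G.Adj i w ∧ G.Adj j w
  · obtain ⟨i, j, w, hi, hj, hij, hw, hiw, hjw⟩ := hshare
    have h2 : G.spvc ≤ 2 := by
      refine spvc_le_of_clique (fun x => if x = w then 0 else 1)
        (fun a => if a = i ∨ a = j then w else b a) (fun a ha => ?_) hclique
        (fun u v hu hv => ?_)
      · split_ifs with h
        · rcases h with rfl | rfl
          · exact ⟨hiw, hw⟩
          · exact ⟨hjw, hw⟩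
        · exact hb a ha
      · -- Only one simplicial vertex is different from `i` and `j`.
        have huv : ¬ (u = i ∨ u = j) → ¬ (v = i ∨ v = j) → u = v := by
          rw [hS] at hi hj hu hv
          grind
        grind
    exact Or.inl (by omega)
  · push Not at hshare
    have ha₁ := (hS a₁).2 (Or.inl rfl)
    have ha₂ := (hS a₂).2 (Or.inr (Or.inl rfl))
    have ha₃ := (hS a₃).2 (Or.inr (Or.inr rfl))
    rcases hn.lt_or_eq with hn | hn
    · left
      have h3 : G.spvc ≤ 3 := by
        refine spvc_le_of_clique (fun x => if x = b a₁ then 0 else if x = b a₂ then 1 else 2)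
          b hb hclique (fun u v hu hv => ?_)
        rw [hS] at hu hv
        grind
      omega
    · right
      have hne : ∀ u v, G.IsSimplicialVertex u → ¬ G.IsSimplicialVertex v → v ≠ u := by
        rintro u v hu hv rfl
        exact hv hu
      have hb_ne : ∀ u v, G.IsSimplicialVertex u → G.IsSimplicialVertex v → u ≠ v →
          b u ≠ b v := fun u v hu hv huv h =>
        hshare u v (b u) hu hv huv (hb u hu).2 (hb u hu).1 (h ▸ (hb v hv).1)
      have hbb : ∀ u v, G.IsSimplicialVertex u → G.IsSimplicialVertex v → u ≠ v →
          G.Adj (b u) (b v) := fun u v hu hv huv =>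
        hclique _ _ (hb u hu).2 (hb v hv).2 (hb_ne u v hu hv huv)
      have hba : ∀ u v, G.IsSimplicialVertex u → G.IsSimplicialVertex v → u ≠ v →
          ¬ G.Adj (b u) v := fun u v hu hv huv h =>
        hshare u v (b u) hu hv huv (hb u hu).2 (hb u hu).1 h.symm
      have haa : ∀ u v, G.IsSimplicialVertex u → G.IsSimplicialVertex v → u ≠ v →
          ¬ G.Adj u v := fun u v hu hv huv h =>
        hba u v hu hv huv (hu (b u) v (hb u hu).1 h (hne _ _ hv (hb u hu).2))
      refine nonempty_iso_of_lt hn.symm _ ![b a₁, b a₂, b a₃, a₁, a₂, a₃] ?_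
      simp [Fin.forall_fin_succ, SpvcExtremal.net, h₁₂, h₁₃, h₂₃, (hb a₁ ha₁).1.symm,
        (hb a₂ ha₂).1.symm, (hb a₃ ha₃).1.symm, hbb a₁ a₂ ha₁ ha₂ h₁₂, hbb a₁ a₃ ha₁ ha₃ h₁₃,
        hbb a₂ a₃ ha₂ ha₃ h₂₃, hb_ne a₁ a₂ ha₁ ha₂ h₁₂, hb_ne a₁ a₃ ha₁ ha₃ h₁₃,
        hb_ne a₂ a₃ ha₂ ha₃ h₂₃, hba a₁ a₂ ha₁ ha₂ h₁₂, hba a₁ a₃ ha₁ ha₃ h₁₃,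
        hba a₂ a₁ ha₂ ha₁ h₁₂.symm, hba a₂ a₃ ha₂ ha₃ h₂₃, hba a₃ a₁ ha₃ ha₁ h₁₃.symm,
        hba a₃ a₂ ha₃ ha₂ h₂₃.symm, haa a₁ a₂ ha₁ ha₂ h₁₂, haa a₁ a₃ ha₁ ha₃ h₁₃,
        haa a₂ a₃ ha₂ ha₃ h₂₃, hne a₁ _ ha₁ (hb a₁ ha₁).2, hne a₁ _ ha₁ (hb a₂ ha₂).2,
        hne a₁ _ ha₁ (hb a₃ ha₃).2, hne a₂ _ ha₂ (hb a₁ ha₁).2, hne a₂ _ ha₂ (hb a₂ ha₂).2,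
        hne a₂ _ ha₂ (hb a₃ ha₃).2, hne a₃ _ ha₃ (hb a₁ ha₁).2, hne a₃ _ ha₃ (hb a₂ ha₂).2,
        hne a₃ _ ha₃ (hb a₃ ha₃).2]

/-- The strong proper vertex-connection number of a connected graph of order `n ≥ 6` other than the
net is at most `n - 4`. -/
theorem spvc_add_four_le_or_net [Fintype V] (hG : G.Connected) (hn : 6 ≤ Fintype.card V) :
    G.spvc + 4 ≤ Fintype.card V ∨ Nonempty (G ≃g SpvcExtremal.net) := by
  classical
  by_cases hfar : ∃ x y, G.Distant x y ∧ ¬ G.IsSimplicialVertex x ∧ ¬ G.IsSimplicialVertex y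
  · obtain ⟨x, y, h, hx, hy⟩ := hfar
    exact Or.inl (spvc_add_four_le_of_distant hG h hx hy)
  have hd : ∀ x y, G.Distant x y → G.IsSimplicialVertex x ∨ G.IsSimplicialVertex y := by
    intro x y h
    by_contra! hcon
    exact hfar ⟨x, y, h, hcon⟩
  obtain ⟨S, hS⟩ : ∃ S : Finset V, ∀ x, x ∈ S ↔ G.IsSimplicialVertex x :=
    ⟨Finset.univ.filter G.IsSimplicialVertex, by simp⟩
  by_cases h4 : 4 ≤ S.card
  · left
    have := spvc_add_card_le_of_not_isSimplicialVertex hG id S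
      (fun x hx h => hx ((hS x).1 h)) (fun x y _ _ h => h.ne)
    omega
  obtain ⟨p, hp⟩ : ∃ p, ¬ G.IsSimplicialVertex p := by
    by_contra! hcon
    have : S = Finset.univ := Finset.eq_univ_of_forall fun x => (hS x).2 (hcon x)
    rw [this, Finset.card_univ] at h4
    omega
  have hcard : S.card = 0 ∨ S.card = 1 ∨ S.card = 2 ∨ S.card = 3 := by omega
  rcases hcard with h | h | h | h
  · left
    have hempty : ∀ x, ¬ G.IsSimplicialVertex x := fun x hx => by
      simpa [Finset.card_eq_zero.1 h] using (hS x).2 hx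
    have := spvc_le_one_of_forall_not_distant (G := G)
      fun u v huv => (hd u v huv).elim (hempty u) (hempty v)
    omega
  · left
    obtain ⟨a, rfl⟩ := Finset.card_eq_one.1 h
    have := spvc_le_two_of_one_simplicial hG (a := a) (fun x => by simp [← hS x]) hp hd
    omega
  · left
    obtain ⟨a₁, a₂, h₁₂, rfl⟩ := Finset.card_eq_two.1 h
    have hS' : ∀ x, G.IsSimplicialVertex x ↔ x = a₁ ∨ x = a₂ := fun x => by simp [← hS x]
    -- Merging two pairs of colors, or three colors into one, saves two colors.
    by_cases hm : ∃ x y u v, ¬ G.IsSimplicialVertex x ∧ ¬ G.IsSimplicialVertex y ∧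
        ¬ G.IsSimplicialVertex u ∧ ¬ G.IsSimplicialVertex v ∧ x ≠ y ∧ u ≠ v ∧ ¬ G.Adj x y ∧
        ¬ G.Adj u v ∧ u ≠ x ∧ u ≠ y ∧ v ≠ x ∧ v ≠ y
    · obtain ⟨x, y, u, v, hx, hy, hu, hv, hxy, huv, hnxy, hnuv, h₁, h₂, h₃, h₄⟩ := hm
      rw [hS'] at hx hy hu hv
      have hB : ({a₁, a₂, y, v} : Finset V).card = 4 := by
        grind
      rw [← hB]
      refine spvc_add_card_le_of_not_isSimplicialVertex hG
        (fun z => if z = y then x else if z = v then u else z) _ (fun z hz => ?_)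
        (fun z w _ _ hzw => ?_)
      · rw [hS'] at hz
        simp only [Finset.mem_insert, Finset.mem_singleton]
        grind
      · grind [G.adj_comm, G.irrefl]
    by_cases ht : ∃ x y z, ¬ G.IsSimplicialVertex x ∧ ¬ G.IsSimplicialVertex y ∧
        ¬ G.IsSimplicialVertex z ∧ x ≠ y ∧ x ≠ z ∧ y ≠ z ∧ ¬ G.Adj x y ∧ ¬ G.Adj x z ∧
        ¬ G.Adj y z
    · obtain ⟨x, y, z, hx, hy, hz, hxy, hxz, hyz, hnxy, hnxz, hnyz⟩ := ht
      rw [hS'] at hx hy hz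
      have hB : ({a₁, a₂, y, z} : Finset V).card = 4 := by
        grind
      rw [← hB]
      refine spvc_add_card_le_of_not_isSimplicialVertex hG
        (fun w => if w = y ∨ w = z then x else w) _ (fun w hw => ?_) (fun w w' _ _ hww => ?_)
      · rw [hS'] at hw
        simp only [Finset.mem_insert, Finset.mem_singleton]
        grind
      · grind [G.adj_comm, G.irrefl]
    obtain ⟨q, hq, hclique⟩ := exists_forall_adj_of_no_matching (G := G)
      (P := {x | ¬ G.IsSimplicialVertex x}) ⟨p, hp⟩
      (fun x hx y hy u hu v hv hxy huv hnxy hnuv => by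
        by_contra! hcon
        exact hm ⟨x, y, u, v, hx, hy, hu, hv, hxy, huv, hnxy, hnuv, hcon⟩)
      (fun x hx y hy z hz hxy hxz hyz hnxy hnxz => by
        by_contra hcon
        exact ht ⟨x, y, z, hx, hy, hz, hxy, hxz, hyz, hnxy, hnxz, hcon⟩)
    have := spvc_le_two_of_two_simplicial hG hS' hd hq
      fun x y hx hy hxq hyq hxy => hclique x hx y hy hxq hyq hxy
    omega
  · obtain ⟨a₁, a₂, a₃, h₁₂, h₁₃, h₂₃, rfl⟩ := Finset.card_eq_three.1 h
    have hS' : ∀ x, G.IsSimplicialVertex x ↔ x = a₁ ∨ x = a₂ ∨ x = a₃ := fun x => by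
      simp [← hS x]
    by_cases hclique : ∃ x y, ¬ G.IsSimplicialVertex x ∧ ¬ G.IsSimplicialVertex y ∧ x ≠ y ∧
        ¬ G.Adj x y
    · left
      obtain ⟨x, y, hx, hy, hxy, hnxy⟩ := hclique
      rw [hS'] at hx hy
      have hB : ({a₁, a₂, a₃, y} : Finset V).card = 4 := by
        grind
      rw [← hB]
      refine spvc_add_card_le_of_not_isSimplicialVertex hG
        (fun z => if z = y then x else z) _ (fun z hz => ?_) (fun z w _ _ hzw => ?_)
      · rw [hS'] at hz
        simp only [Finset.mem_insert, Finset.mem_singleton]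
        grind
      · grind [G.adj_comm, G.irrefl]
    · push Not at hclique
      exact spvc_add_four_le_or_net_of_three_simplicial hG hn h₁₂ h₁₃ h₂₃ hS' hp hclique

/-! ### Graphs of order at most five -/

theorem nonempty_iso_triangle [Fintype V] (hn : Fintype.card V = 3)
    (h : ∀ u v, u ≠ v → G.Adj u v) : Nonempty (G ≃g SpvcExtremal.triangle) := by
  classical
  obtain ⟨a, b, c, hab, hac, hbc, -⟩ := Finset.card_eq_three.1 (Finset.card_univ.trans hn)
  refine nonempty_iso_of_lt hn _ ![a, b, c] ?_
  simp [Fin.forall_fin_succ, SpvcExtremal.triangle, h a b hab, h a c hac, h b c hbc, hab, hac, hbc]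

/-- A graph of order four and diameter two consists of a path `u, w, v` with `u` and `v` nonadjacent,
and a fourth vertex `x`. -/
theorem nonempty_iso_of_card_eq_four [Fintype V] (hn : Fintype.card V = 4)
    (hd : ∀ u v, ¬ G.Distant u v) {u v : V} (huv : u ≠ v) (hnuv : ¬ G.Adj u v) :
    Nonempty (G ≃g SpvcExtremal.claw) ∨ Nonempty (G ≃g SpvcExtremal.fourCycle) ∨
      Nonempty (G ≃g SpvcExtremal.paw) ∨ Nonempty (G ≃g SpvcExtremal.diamond) := by
  classical
  obtain ⟨w, huw, hwv⟩ := exists_adj_adj_of_not_distant (hd u v) huv hnuv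
  have huw' := huw.ne
  have hwv' := hwv.ne
  obtain ⟨x, hx⟩ : ∃ x, x ∉ ({u, v, w} : Finset V) := by
    by_contra! hcon
    have := Finset.card_le_card (fun y _ => hcon y : (Finset.univ : Finset V) ⊆ {u, v, w})
    have := Finset.card_le_three (a := u) (b := v) (c := w)
    rw [Finset.card_univ] at *
    omega
  have hx : x ≠ u ∧ x ≠ v ∧ x ≠ w := by simpa using hx
  obtain ⟨hxu, hxv, hxw⟩ := hx
  have hall : ∀ y, y = u ∨ y = v ∨ y = w ∨ y = x := by
    intro y
    have h4 : ({u, v, w, x} : Finset V) = Finset.univ := by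
      rw [← Finset.card_eq_iff_eq_univ, hn]
      grind
    have hy : y ∈ ({u, v, w, x} : Finset V) := by
      rw [h4]
      exact Finset.mem_univ y
    simpa using hy
  by_cases hu : G.Adj u x <;> by_cases hv : G.Adj x v <;> by_cases hw : G.Adj w x
  · refine Or.inr (Or.inr (Or.inr (nonempty_iso_of_lt hn _ ![u, w, x, v] ?_)))
    simp [Fin.forall_fin_succ, SpvcExtremal.diamond]
    grind [G.adj_comm]
  · refine Or.inr (Or.inl (nonempty_iso_of_lt hn _ ![u, w, v, x] ?_))
    simp [Fin.forall_fin_succ, SpvcExtremal.fourCycle]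
    grind [G.adj_comm]
  · refine Or.inr (Or.inr (Or.inl (nonempty_iso_of_lt hn _ ![w, u, x, v] ?_)))
    simp [Fin.forall_fin_succ, SpvcExtremal.paw]
    grind [G.adj_comm]
  · exact absurd ⟨hxv, hv, fun z h h' => by
      rcases hall z with rfl | rfl | rfl | rfl <;> grind [G.adj_comm, G.irrefl]⟩ (hd x v)
  · refine Or.inr (Or.inr (Or.inl (nonempty_iso_of_lt hn _ ![w, v, x, u] ?_)))
    simp [Fin.forall_fin_succ, SpvcExtremal.paw]
    grind [G.adj_comm]
  · exact absurd ⟨hxu.symm, hu, fun z h h' => by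
      rcases hall z with rfl | rfl | rfl | rfl <;> grind [G.adj_comm, G.irrefl]⟩ (hd u x)
  · refine Or.inl (nonempty_iso_of_lt hn _ ![w, u, v, x] ?_)
    simp [Fin.forall_fin_succ, SpvcExtremal.claw]
    grind [G.adj_comm]
  · exact absurd ⟨hxv, hv, fun z h h' => by
      rcases hall z with rfl | rfl | rfl | rfl <;> grind [G.adj_comm, G.irrefl]⟩ (hd x v)

/-- A connected graph of order five and diameter at least three consists of a path `a, b, c, d`
between vertices at distance three, and a fifth vertex `e` that is not adjacent to both `a`
and `d`. -/
theorem nonempty_iso_of_card_eq_five [Fintype V] (hG : G.Connected) (hn : Fintype.card V = 5)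
    {a v : V} (hav : G.Distant a v) :
    Nonempty (G ≃g SpvcExtremal.fivePath) ∨ Nonempty (G ≃g SpvcExtremal.fork) ∨
      Nonempty (G ≃g SpvcExtremal.bull) ∨ Nonempty (G ≃g SpvcExtremal.lollipop) ∨
      Nonempty (G ≃g SpvcExtremal.banner) ∨ Nonempty (G ≃g SpvcExtremal.kite) := by
  classical
  obtain ⟨b, c, d, hab, hbc, hcd, hd⟩ := hav.exists_distant_of_path hG
  obtain ⟨had, hnad, hno⟩ := hd
  have hnac : ¬ G.Adj a c := fun h => hno c h hcd
  have hnbd : ¬ G.Adj b d := hno b hab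
  have hac : a ≠ c := by rintro rfl; exact hnad hcd
  have hbd : b ≠ d := by rintro rfl; exact hnad hab
  have hab' := hab.ne
  have hbc' := hbc.ne
  have hcd' := hcd.ne
  obtain ⟨e, he⟩ : ∃ e, e ∉ ({a, b, c, d} : Finset V) := by
    by_contra! hcon
    have := Finset.card_le_card (fun y _ => hcon y : (Finset.univ : Finset V) ⊆ {a, b, c, d})
    have := Finset.card_le_four (a := a) (b := b) (c := c) (d := d)
    rw [Finset.card_univ] at *
    omega
  have he : e ≠ a ∧ e ≠ b ∧ e ≠ c ∧ e ≠ d := by simpa using he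
  obtain ⟨hea, heb, hec, hed⟩ := he
  have hall : ∀ y, y = a ∨ y = b ∨ y = c ∨ y = d ∨ y = e := by
    intro y
    have h5 : ({a, b, c, d, e} : Finset V) = Finset.univ := by
      rw [← Finset.card_eq_iff_eq_univ, hn]
      grind
    have hy : y ∈ ({a, b, c, d, e} : Finset V) := by
      rw [h5]
      exact Finset.mem_univ y
    simpa using hy
  have hae : ¬ (G.Adj a e ∧ G.Adj e d) := fun h => hno e h.1 h.2
  have hiso : G.Adj a e ∨ G.Adj b e ∨ G.Adj c e ∨ G.Adj e d := by
    have : Nontrivial V := ⟨a, e, hea.symm⟩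
    obtain ⟨y, hy⟩ := hG.preconnected.exists_adj_of_nontrivial e
    rcases hall y with rfl | rfl | rfl | rfl | rfl
    · exact Or.inl hy.symm
    · exact Or.inr (Or.inl hy.symm)
    · exact Or.inr (Or.inr (Or.inl hy.symm))
    · exact Or.inr (Or.inr (Or.inr hy))
    · exact absurd hy (G.irrefl)
  clear hall hno hav
  by_cases h₁ : G.Adj a e <;> by_cases h₂ : G.Adj b e <;> by_cases h₃ : G.Adj c e <;>
    by_cases h₄ : G.Adj e d
  · exact absurd ⟨h₁, h₄⟩ hae
  · refine Or.inr (Or.inr (Or.inr (Or.inr (Or.inr (nonempty_iso_of_lt hn _ ![a, b, e, c, d] ?_)))))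
    simp [Fin.forall_fin_succ, SpvcExtremal.kite]
    grind [G.adj_comm]
  · exact absurd ⟨h₁, h₄⟩ hae
  · refine Or.inr (Or.inr (Or.inr (Or.inl (nonempty_iso_of_lt hn _ ![b, a, e, c, d] ?_))))
    simp [Fin.forall_fin_succ, SpvcExtremal.lollipop]
    grind [G.adj_comm]
  · exact absurd ⟨h₁, h₄⟩ hae
  · refine Or.inr (Or.inr (Or.inr (Or.inr (Or.inl (nonempty_iso_of_lt hn _ ![c, b, a, e, d] ?_)))))
    simp [Fin.forall_fin_succ, SpvcExtremal.banner]
    grind [G.adj_comm]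
  · exact absurd ⟨h₁, h₄⟩ hae
  · refine Or.inl (nonempty_iso_of_lt hn _ ![e, a, b, c, d] ?_)
    simp [Fin.forall_fin_succ, SpvcExtremal.fivePath]
    grind [G.adj_comm]
  · refine Or.inr (Or.inr (Or.inr (Or.inr (Or.inr (nonempty_iso_of_lt hn _ ![d, c, e, b, a] ?_)))))
    simp [Fin.forall_fin_succ, SpvcExtremal.kite]
    grind [G.adj_comm]
  · refine Or.inr (Or.inr (Or.inl (nonempty_iso_of_lt hn _ ![b, c, e, a, d] ?_)))
    simp [Fin.forall_fin_succ, SpvcExtremal.bull]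
    grind [G.adj_comm]
  · refine Or.inr (Or.inr (Or.inr (Or.inr (Or.inl (nonempty_iso_of_lt hn _ ![b, c, d, e, a] ?_)))))
    simp [Fin.forall_fin_succ, SpvcExtremal.banner]
    grind [G.adj_comm]
  · refine Or.inr (Or.inl (nonempty_iso_of_lt hn _ ![b, a, e, c, d] ?_))
    simp [Fin.forall_fin_succ, SpvcExtremal.fork]
    grind [G.adj_comm]
  · refine Or.inr (Or.inr (Or.inr (Or.inl (nonempty_iso_of_lt hn _ ![c, d, e, b, a] ?_))))
    simp [Fin.forall_fin_succ, SpvcExtremal.lollipop]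
    grind [G.adj_comm]
  · refine Or.inr (Or.inl (nonempty_iso_of_lt hn _ ![c, d, e, b, a] ?_))
    simp [Fin.forall_fin_succ, SpvcExtremal.fork]
    grind [G.adj_comm]
  · refine Or.inl (nonempty_iso_of_lt hn _ ![a, b, c, d, e] ?_)
    simp [Fin.forall_fin_succ, SpvcExtremal.fivePath]
    grind [G.adj_comm]
  · exact absurd hiso (by simp [h₁, h₂, h₃, h₄])

end SimpleGraph

open SimpleGraph SpvcExtremal

theorem theorem7 {V : Type*} [Fintype V] [Nontrivial V] (G : SimpleGraph V)
    (hG : G.Connected) :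
    (G.spvc : ℤ) = (Fintype.card V : ℤ) - 3 ↔
      Nonempty (G ≃g SpvcExtremal.triangle) ∨
      Nonempty (G ≃g SpvcExtremal.claw) ∨
      Nonempty (G ≃g SpvcExtremal.fourCycle) ∨
      Nonempty (G ≃g SpvcExtremal.paw) ∨
      Nonempty (G ≃g SpvcExtremal.diamond) ∨
      Nonempty (G ≃g SpvcExtremal.fivePath) ∨
      Nonempty (G ≃g SpvcExtremal.fork) ∨
      Nonempty (G ≃g SpvcExtremal.bull) ∨
      Nonempty (G ≃g SpvcExtremal.lollipop) ∨
      Nonempty (G ≃g SpvcExtremal.banner) ∨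
      Nonempty (G ≃g SpvcExtremal.kite) ∨
      Nonempty (G ≃g SpvcExtremal.net) := by
  constructor
  · intro h
    have hcard : Fintype.card V = 3 ∨ Fintype.card V = 4 ∨ Fintype.card V = 5 ∨
        6 ≤ Fintype.card V := by omega
    rcases hcard with hn | hn | hn | hn
    · refine Or.inl (nonempty_iso_triangle hn fun u v huv => ?_)
      by_contra hnuv
      have := one_le_spvc_of_not_adj hG huv hnuv
      omega
    · have hd : ∀ u v, ¬ G.Distant u v := fun u v huv => by
        have := two_le_spvc_of_distant hG huv
        omega
      by_cases hex : ∃ u v, u ≠ v ∧ ¬ G.Adj u v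
      · obtain ⟨u, v, huv, hnuv⟩ := hex
        have := nonempty_iso_of_card_eq_four hn hd huv hnuv
        tauto
      · push Not at hex
        have := spvc_eq_zero_of_forall_adj hex
        omega
    · by_cases hex : ∃ u v, G.Distant u v
      · obtain ⟨u, v, huv⟩ := hex
        have := nonempty_iso_of_card_eq_five hG hn huv
        tauto
      · push Not at hex
        have := spvc_le_one_of_forall_not_distant hex
        omega
    · rcases spvc_add_four_le_or_net hG hn with h' | h'
      · omega
      · tauto
  · rintro (⟨⟨e⟩⟩ | ⟨⟨e⟩⟩ | ⟨⟨e⟩⟩ | ⟨⟨e⟩⟩ | ⟨⟨e⟩⟩ | ⟨⟨e⟩⟩ | ⟨⟨e⟩⟩ | ⟨⟨e⟩⟩ | ⟨⟨e⟩⟩ | ⟨⟨e⟩⟩ | ⟨⟨e⟩⟩ | ⟨⟨e⟩⟩) <;>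
      rw [spvc_congr e, card_eq_of_iso e]
    · simp [spvc_triangle]
    · simp [spvc_claw (e.connected_iff.1 hG)]
    · simp [spvc_fourCycle (e.connected_iff.1 hG)]
    · simp [spvc_paw (e.connected_iff.1 hG)]
    · simp [spvc_diamond (e.connected_iff.1 hG)]
    · simp [spvc_fivePath (e.connected_iff.1 hG)]
    · simp [spvc_fork (e.connected_iff.1 hG)]
    · simp [spvc_bull (e.connected_iff.1 hG)]
    · simp [spvc_lollipop (e.connected_iff.1 hG)]
    · simp [spvc_banner (e.connected_iff.1 hG)]
    · simp [spvc_kite (e.connected_iff.1 hG)]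
    · simp [spvc_net (e.connected_iff.1 hG)]
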